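/- Let $d\ge 2$, $n\ge 2$ and $0<\varepsilon<\frac{1}{16(d+1)}$. Let $\mathbf P\subset\mathbb E^d$ be a $d$-dimensional convex polytope, let $\mathbf x_1,\dots,\mathbf x_n\in\mathbb E^d$ and $\tau_1,\dots,\tau_n>0$, and suppose that $\mathcal P=\{\mathbf x_i+\tau_i\mathbf P \mid i=1,\dots,n\}$ is a weakly non-separable (WNS) family, i.e. every hyperplane that is parallel to some facet of $\mathbf P$ and intersects $\operatorname{conv}\left(\bigcup\mathcal P\right)$ intersects a member of $\mathcal P$. Assume that the smallest positive homothetic copy of $\mathbf P$ covering $\bigcup\mathcal P$, i.e. the copy $\mathbf z+\rho\mathbf P\supseteq\bigcup\mathcal P$ ($\mathbf z\in\mathbb E^d$, $\rho>0$) of smallest ratio $\rho$, satisfies $$\rho\ \ge\ \left(\frac{d+1}{2}-\varepsilon\right)\sum_{i=1}^n\tau_i .$$ Then for every $d$-dimensional simplex $\mathbf S\subset\mathbb E^d$ $$d_{BM}(\mathbf P,\mathbf S)\le 1+16(d+1)\varepsilon ,$$ where the Banach–Mazur distance of convex bodies $\mathbf K,\mathbf L\subset\mathbb E^d$ is $$d_{BM}(\mathbf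 K,\mathbf L)=\inf\{\lambda>0 \mid \mathbf K+\mathbf u\subseteq T(\mathbf L+\mathbf v)\subseteq\lambda(\mathbf K+\mathbf u)\},$$ the infimum being taken over all invertible linear operators $T:\mathbb E^d\to\mathbb E^d$ and all vectors $\mathbf u,\mathbf v\in\mathbb E^d$. -/

import Mathlib

open scoped Pointwise

/-- `P` is a `d`-dimensional convex polytope in Euclidean `d`-space: the convex hull of finitely
many points, with nonempty interior. -/
def IsFullDimPolytope {d : ℕ} (P : Set (EuclideanSpace ℝ (Fin d))) : Prop :=
  (∃ V : Finset (EuclideanSpace ℝ (Fin d)),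
    P = convexHull ℝ (V : Set (EuclideanSpace ℝ (Fin d)))) ∧ (interior P).Nonempty

/-- `F` is a facet of `P`: a nonempty (exposed) face of dimension `d - 1`. -/
def IsFacet {d : ℕ} (P F : Set (EuclideanSpace ℝ (Fin d))) : Prop :=
  IsExposed ℝ P F ∧ F.Nonempty ∧ Module.finrank ℝ (vectorSpan ℝ F) + 1 = d

/-- The positive homothetic copy `x + τ P`. -/
def homothet {d : ℕ} (P : Set (EuclideanSpace ℝ (Fin d)))
    (x : EuclideanSpace ℝ (Fin d)) (τ : ℝ) : Set (EuclideanSpace ℝ (Fin d)) :=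
  x +ᵥ (τ • P)

/-- The family `x i + τ i P` is weakly non-separable: every hyperplane parallel to some facet of
`P` and intersecting the convex hull of the union of the family intersects some member. -/
def IsWNSFamily {d n : ℕ} (P : Set (EuclideanSpace ℝ (Fin d)))
    (x : Fin n → EuclideanSpace ℝ (Fin d)) (τ : Fin n → ℝ) : Prop :=
  ∀ F : Set (EuclideanSpace ℝ (Fin d)), IsFacet P F →
    ∀ H : AffineSubspace ℝ (EuclideanSpace ℝ (Fin d)), H.Parallel (affineSpan ℝ F) →
      ((H : Set (EuclideanSpace ℝ (Fin d))) ∩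
        convexHull ℝ (⋃ i, homothet P (x i) (τ i))).Nonempty →
      ∃ i, ((H : Set (EuclideanSpace ℝ (Fin d))) ∩ homothet P (x i) (τ i)).Nonempty

/-- The ratio of the smallest positive homothetic copy of `P` that covers `A`. -/
noncomputable def smallestCoveringRatio {d : ℕ} (P A : Set (EuclideanSpace ℝ (Fin d))) : ℝ :=
  sInf {r : ℝ | 0 < r ∧ ∃ z : EuclideanSpace ℝ (Fin d), A ⊆ homothet P z r}

/-- The Banach–Mazur distance of `K` and `L`: the infimum of all `r > 0` such that
`K + u ⊆ T (L + v) ⊆ r (K + u)` for some invertible linear `T` and vectors `u`, `v`. It takes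
values in `[0, ∞]`, the infimum of the empty set being `∞`. -/
noncomputable def banachMazurDist {d : ℕ} (K L : Set (EuclideanSpace ℝ (Fin d))) : ENNReal :=
  sInf {a : ENNReal | ∃ r : ℝ, 0 < r ∧ a = ENNReal.ofReal r ∧
    ∃ (T : EuclideanSpace ℝ (Fin d) ≃ₗ[ℝ] EuclideanSpace ℝ (Fin d))
      (u v : EuclideanSpace ℝ (Fin d)),
      u +ᵥ K ⊆ T '' (v +ᵥ L) ∧ T '' (v +ᵥ L) ⊆ r • (u +ᵥ K)}

/-! The argument passes through the asymmetry of `P`. If `-P` fits in a translate of `s P`, `s ≥ 1`,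
then a WNS family has a cover of ratio `(s + 1) / 2 * ∑ τ i`
(`IsWNSFamily.smallestCoveringRatio_le`): its projection along any facet normal is a chain of
intervals without gaps, and a `τ`-weighted centre bounds how far the chain reaches. A ratio near `(d
+ 1) / 2 * ∑ τ i` therefore excludes `s = d - 4 * ε`.

Helly's theorem and separation turn this failure into `d + 1` functionals with sum zero
(`exists_functionals_of_forall_not_neg_subset`). Normalised, they act as barycentric coordinates on
`P`, each almost `1` somewhere on `P`. The affine map with these coordinates sends `P` into the
simplex and onto a set containing a slightly smaller concentric copy, which bounds the Banach–Mazur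
distance. -/

/-! ### Facets of polytopes -/

theorem IsFullDimPolytope.convex {d : ℕ} {P : Set (EuclideanSpace ℝ (Fin d))}
    (hP : IsFullDimPolytope P) : Convex ℝ P := by
  obtain ⟨⟨V, rfl⟩, -⟩ := hP
  exact convex_convexHull ℝ _

theorem IsFullDimPolytope.isCompact {d : ℕ} {P : Set (EuclideanSpace ℝ (Fin d))}
    (hP : IsFullDimPolytope P) : IsCompact P := by
  obtain ⟨⟨V, rfl⟩, -⟩ := hP
  exact V.finite_toSet.isCompact_convexHull ℝ

theorem IsFullDimPolytope.nonempty {d : ℕ} {P : Set (EuclideanSpace ℝ (Fin d))}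
    (hP : IsFullDimPolytope P) : P.Nonempty :=
  hP.2.mono interior_subset

/-- A point of a convex hull at which a linear functional attains its maximum over the hull is a
convex combination of generators with the same property. -/
theorem mem_convexHull_filter_of_forall_le {E : Type*} [AddCommGroup E] [Module ℝ E]
    (V : Finset E) (l : E →ₗ[ℝ] ℝ) {M : ℝ} (hl : ∀ v ∈ V, l v ≤ M) {y : E}
    (hy : y ∈ convexHull ℝ (V : Set E)) (hyM : l y = M) :
    y ∈ convexHull ℝ ((V.filter fun v => l v = M : Finset E) : Set E) := by
  classical
  rw [Finset.mem_convexHull'] at hy ⊢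
  obtain ⟨w, hw0, hw1, hwy⟩ := hy
  have hsum : ∑ v ∈ V, w v * (M - l v) = 0 := by
    have h : l y = ∑ v ∈ V, w v * l v := by rw [← hwy]; simp
    simp only [mul_sub, Finset.sum_sub_distrib, ← Finset.sum_mul, hw1, ← h, hyM]
    ring
  have hzero := (Finset.sum_eq_zero_iff_of_nonneg
    fun v hv => mul_nonneg (hw0 v hv) (sub_nonneg.2 (hl v hv))).1 hsum
  have hz : ∀ v ∈ V, w v ≠ 0 → l v = M := fun v hv hne => by
    have := (mul_eq_zero.1 (hzero v hv)).resolve_left hne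
    linarith
  refine ⟨w, fun v hv => hw0 v (Finset.mem_filter.1 hv).1, ?_, ?_⟩
  · rw [Finset.sum_filter_of_ne hz, hw1]
  · rw [Finset.sum_filter_of_ne fun v hv hne => hz v hv fun h => hne (by simp [h]), hwy]

/-- The segment from an point of a closed set to a point outside it contains a point of
the set that is not interior. -/
theorem exists_lineMap_mem_diff_interior {E : Type*} [NormedAddCommGroup E] [NormedSpace ℝ E]
    {P : Set E} (hP : IsClosed P) {o q : E} (ho : o ∈ P) (hq : q ∉ P) :
    ∃ t ∈ Set.Ico (0 : ℝ) 1, AffineMap.lineMap o q t ∈ P \ interior P := by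
  have hcont : Continuous fun t : ℝ => AffineMap.lineMap o q t := AffineMap.lineMap_continuous
  obtain ⟨t, ⟨⟨ht0, ht1⟩, htP⟩, hmax⟩ :=
    (isCompact_Icc.inter_right (hP.preimage hcont)).exists_isGreatest
      (s := Set.Icc (0 : ℝ) 1 ∩ (fun t : ℝ => AffineMap.lineMap o q t) ⁻¹' P)
      ⟨0, by simpa using ho⟩
  have ht1' : t < 1 := by
    refine lt_of_le_of_ne ht1 ?_
    rintro rfl
    exact hq (by simpa using htP)
  refine ⟨t, ⟨ht0, ht1'⟩, htP, fun hint => ?_⟩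
  have hev : ∀ᶠ s in nhdsWithin t (Set.Ioi t), s ∈ Set.Ioo t 1 ∧ AffineMap.lineMap o q s ∈ P :=
    Filter.Eventually.and (Ioo_mem_nhdsGT ht1') (((hcont.tendsto t).eventually
      (mem_interior_iff_mem_nhds.1 hint)).filter_mono nhdsWithin_le_nhds)
  obtain ⟨s, ⟨hs1, hs2⟩, hsP⟩ := hev.exists
  exact absurd (hmax ⟨⟨ht0.trans hs1.le, hs2.le⟩, hsP⟩) (not_le.2 hs1)

/-- Every point outside a full-dimensional polytope is separated from it by a facet. -/
theorem IsFullDimPolytope.exists_isFacet_lt {d : ℕ} {P : Set (EuclideanSpace ℝ (Fin d))}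
    (hP : IsFullDimPolytope P) {q : EuclideanSpace ℝ (Fin d)} (hq : q ∉ P) :
    ∃ (l : StrongDual ℝ (EuclideanSpace ℝ (Fin d))) (M : ℝ), (∀ x ∈ P, l x ≤ M) ∧
      IsFacet P {x ∈ P | l x = M} ∧
      vectorSpan ℝ {x ∈ P | l x = M} = LinearMap.ker (l : EuclideanSpace ℝ (Fin d) →ₗ[ℝ] ℝ) ∧
      M < l q := by
  classical
  have hconv := hP.convex
  have hcomp := hP.isCompact
  obtain ⟨⟨V, hV⟩, hint⟩ := hP
  -- A generic interior point `o` avoids every proper flat spanned by `q` and generators: these are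
  -- finitely many null sets. The segment from `o` to `q` then leaves `P` through a facet rather
  -- than a lower face.
  obtain ⟨o, hoP, ho⟩ : ∃ o ∈ interior P, ∀ W ∈ V.powerset,
      o ∈ affineSpan ℝ (insert q (W : Set (EuclideanSpace ℝ (Fin d)))) →
      affineSpan ℝ (insert q (W : Set (EuclideanSpace ℝ (Fin d)))) = ⊤ := by
    by_contra! hcon
    have hsub : interior P ⊆ ⋃ W ∈ V.powerset.filter fun W : Finset (EuclideanSpace ℝ (Fin d)) =>
        affineSpan ℝ (insert q (W : Set (EuclideanSpace ℝ (Fin d)))) ≠ ⊤,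
        (affineSpan ℝ (insert q (W : Set (EuclideanSpace ℝ (Fin d)))) : Set _) := by
      intro o ho
      obtain ⟨W, hW, hoW, hne⟩ := hcon o ho
      simp only [Set.mem_iUnion]
      exact ⟨W, Finset.mem_filter.2 ⟨hW, hne⟩, hoW⟩
    have hnull : MeasureTheory.volume (interior P) = 0 := by
      refine MeasureTheory.measure_mono_null hsub
        ((MeasureTheory.measure_biUnion_null_iff (Finset.countable_toSet _)).2 fun W hW => ?_)
      exact MeasureTheory.Measure.addHaar_affineSubspace _ _ (Finset.mem_filter.1 hW).2
    exact (isOpen_interior.measure_pos MeasureTheory.volume hint).ne' hnull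
  obtain ⟨t, ⟨ht0, ht1⟩, hyP, hyint⟩ :=
    exists_lineMap_mem_diff_interior hcomp.isClosed (interior_subset hoP) hq
  set y := AffineMap.lineMap o q t with hy
  obtain ⟨l, hl⟩ := geometric_hahn_banach_open_point hconv.interior isOpen_interior hyint
  have hle : ∀ x ∈ P, l x ≤ l y := by
    intro x hx
    have hx' : x ∈ closure (interior P) := by
      rw [hconv.closure_interior_eq_closure_of_nonempty_interior hint]
      exact subset_closure hx
    exact closure_minimal (fun a ha => (hl a ha).le)
      (isClosed_le l.continuous continuous_const) hx'
  have hly : l y = l o + t * (l q - l o) := by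
    rw [hy, AffineMap.lineMap_apply]
    simp
    ring
  have hlo := hl o hoP
  have hlq : l y < l q := by nlinarith
  set W := V.filter fun v => l v = l y with hW
  have hVP : ∀ v ∈ V, v ∈ P := fun v hv => hV ▸ subset_convexHull ℝ _ hv
  have hyW : y ∈ convexHull ℝ (W : Set (EuclideanSpace ℝ (Fin d))) :=
    mem_convexHull_filter_of_forall_le V (l : EuclideanSpace ℝ (Fin d) →ₗ[ℝ] ℝ)
      (fun v hv => hle v (hVP v hv)) (hV ▸ hyP) rfl
  -- `o` lies on the line through `q` and `y`, so genericity forces `q` and `W` to span the space;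
  -- hence `W` has dimension at least `d - 1`.
  have htop : affineSpan ℝ (insert q (W : Set (EuclideanSpace ℝ (Fin d)))) = ⊤ := by
    refine ho W (by simp [hW]) ?_
    have h1 : y ∈ affineSpan ℝ (insert q (W : Set (EuclideanSpace ℝ (Fin d)))) :=
      affineSpan_mono ℝ (Set.subset_insert _ _) (convexHull_subset_affineSpan _ hyW)
    have h2 : q ∈ affineSpan ℝ (insert q (W : Set (EuclideanSpace ℝ (Fin d)))) :=
      subset_affineSpan ℝ _ (Set.mem_insert _ _)
    have h3 : o = AffineMap.lineMap q y (1 / (1 - t)) := by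
      have : (1 - t) ≠ 0 := by linarith
      rw [hy, AffineMap.lineMap_apply, AffineMap.lineMap_apply]
      simp only [vsub_eq_sub, vadd_eq_add]
      have e : t • (q - o) + o - q = (1 - t) • (o - q) := by module
      rw [e, smul_smul, one_div_mul_cancel this]
      module
    rw [h3]
    exact AffineMap.lineMap_mem _ h2 h1
  have hlne : (l : EuclideanSpace ℝ (Fin d) →ₗ[ℝ] ℝ) ≠ 0 := by
    intro h0
    have h : ∀ z, l z = 0 := fun z => LinearMap.congr_fun h0 z
    rw [h, h] at hlq
    exact lt_irrefl _ hlq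
  have hker := Module.Dual.finrank_ker_add_one_of_ne_zero hlne
  rw [finrank_euclideanSpace_fin] at hker
  have hspan : vectorSpan ℝ {x ∈ P | l x = l y} ≤
      LinearMap.ker (l : EuclideanSpace ℝ (Fin d) →ₗ[ℝ] ℝ) := by
    refine Submodule.span_le.2 ?_
    rintro _ ⟨a, ⟨-, ha⟩, b, ⟨-, hb⟩, rfl⟩
    simp [ha, hb]
  have hrank : d ≤ Module.finrank ℝ (vectorSpan ℝ {x ∈ P | l x = l y}) + 1 := by
    have h1 := finrank_vectorSpan_insert_le_set ℝ (W : Set (EuclideanSpace ℝ (Fin d))) q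
    rw [← direction_affineSpan, htop, AffineSubspace.direction_top, finrank_top,
      finrank_euclideanSpace_fin] at h1
    have h2 : vectorSpan ℝ (W : Set (EuclideanSpace ℝ (Fin d))) ≤
        vectorSpan ℝ {x ∈ P | l x = l y} := by
      refine vectorSpan_mono ℝ fun v hv => ?_
      have := Finset.mem_filter.1 hv
      exact ⟨hVP v this.1, this.2⟩
    have h3 := Submodule.finrank_mono h2
    omega
  have heq : vectorSpan ℝ {x ∈ P | l x = l y} =
      LinearMap.ker (l : EuclideanSpace ℝ (Fin d) →ₗ[ℝ] ℝ) :=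
    Submodule.eq_of_le_of_finrank_le hspan (by omega)
  refine ⟨l, l y, hle, ⟨fun _ => ⟨l, ?_⟩, ⟨y, hyP, rfl⟩, by rw [heq]; exact hker⟩, heq, hlq⟩
  ext x
  constructor
  · rintro ⟨hx, hxy⟩
    exact ⟨hx, fun z hz => hxy ▸ hle z hz⟩
  · rintro ⟨hx, hxy⟩
    exact ⟨hx, le_antisymm (hle x hx) (hxy y hyP)⟩

/-! ### Covering weakly non-separable families -/

/-- If finitely many intervals `[a j, e j]` cover `(e i, N]`, then the length of `(e i, N]` is at
most the total length of the intervals that end to the right of `e i`. -/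
theorem sub_le_sum_length_of_cover {ι : Type*} [Fintype ι] (a e : ι → ℝ)
    (hae : ∀ j, a j ≤ e j) (i : ι) (N : ℝ)
    (hcov : ∀ c, e i < c → c ≤ N → ∃ j, a j ≤ c ∧ c ≤ e j) :
    N - e i ≤ ∑ j, if e i < e j then e j - a j else 0 := by
  classical
  have hnn : 0 ≤ ∑ j, if e i < e j then e j - a j else 0 :=
    Finset.sum_nonneg fun j _ => by
      split_ifs
      · linarith [hae j]
      · exact le_rfl
  have hsub : Set.Ioc (e i) N ⊆
      ⋃ j ∈ Finset.univ.filter fun j => e i < e j, Set.Icc (a j) (e j) := by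
    rintro c ⟨hc1, hc2⟩
    obtain ⟨j, hj1, hj2⟩ := hcov c hc1 hc2
    simp only [Set.mem_iUnion]
    exact ⟨j, by simpa using hc1.trans_le hj2, hj1, hj2⟩
  have hvol := (MeasureTheory.measure_mono (μ := MeasureTheory.volume) hsub).trans
    (MeasureTheory.measure_biUnion_finset_le _ _)
  simp only [Real.volume_Ioc, Real.volume_Icc] at hvol
  rw [← ENNReal.ofReal_sum_of_nonneg fun j _ => sub_nonneg.2 (hae j), Finset.sum_filter] at hvol
  exact (ENNReal.ofReal_le_ofReal_iff hnn).1 hvol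

/-- Each unordered pair of distinct indices is counted at most once on the left (not at all on ties
`e i = e j`). -/
theorem sum_mul_sum_ite_lt_le {ι : Type*} [Fintype ι] (τ e : ι → ℝ) (hτ : ∀ i, 0 ≤ τ i) :
    2 * ∑ i, τ i * ∑ j, (if e i < e j then τ j else 0) ≤ (∑ i, τ i) ^ 2 - ∑ i, τ i ^ 2 := by
  classical
  have h1 : ∑ i, τ i * ∑ j, (if e i < e j then τ j else 0) =
      ∑ i, ∑ j, if e i < e j then τ i * τ j else 0 := by
    simp only [Finset.mul_sum, mul_ite, mul_zero]
  have h2 : ∑ i, ∑ j, (if e i < e j then τ i * τ j else 0) =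
      ∑ i, ∑ j, if e j < e i then τ i * τ j else 0 := by
    rw [Finset.sum_comm]
    simp only [mul_comm]
  have h3 : ∑ i, τ i ^ 2 = ∑ i, ∑ j, if i = j then τ i * τ j else 0 := by
    simp [sq]
  have h4 : (∑ i, τ i) ^ 2 = ∑ i, ∑ j, τ i * τ j := by
    rw [sq, Finset.sum_mul_sum]
  rw [h1, two_mul]
  nth_rewrite 2 [h2]
  rw [h3, h4, ← Finset.sum_add_distrib, ← Finset.sum_sub_distrib]
  refine Finset.sum_le_sum fun i _ => ?_
  rw [← Finset.sum_add_distrib, ← Finset.sum_sub_distrib]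
  refine Finset.sum_le_sum fun j _ => ?_
  have hij := mul_nonneg (hτ i) (hτ j)
  rcases lt_trichotomy (e i) (e j) with h | h | h
  · have hne : i ≠ j := by rintro rfl; exact lt_irrefl _ h
    simp [h, hne, h.not_gt]
  · simp only [h, lt_irrefl, if_false]
    split_ifs <;> linarith
  · have hne : i ≠ j := by rintro rfl; exact lt_irrefl _ h
    simp [h, hne, h.not_gt]

/-- In a weakly non-separable family, the hyperplanes parallel to a facet `{x ∈ P | l x = M}` at
levels between those of two points covered by the family meet a member. -/
theorem IsWNSFamily.exists_mem_homothet {d n : ℕ} {P : Set (EuclideanSpace ℝ (Fin d))}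
    {x : Fin n → EuclideanSpace ℝ (Fin d)} {τ : Fin n → ℝ} (hWNS : IsWNSFamily P x τ)
    {l : StrongDual ℝ (EuclideanSpace ℝ (Fin d))} {M : ℝ}
    (hF : IsFacet P {x ∈ P | l x = M})
    (hspan : vectorSpan ℝ {x ∈ P | l x = M} =
      LinearMap.ker (l : EuclideanSpace ℝ (Fin d) →ₗ[ℝ] ℝ))
    {p q : EuclideanSpace ℝ (Fin d)} (hp : p ∈ ⋃ i, homothet P (x i) (τ i))
    (hq : q ∈ ⋃ i, homothet P (x i) (τ i)) {c : ℝ} (hpc : l p < c) (hcq : c ≤ l q) :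
    ∃ j, ∃ y ∈ homothet P (x j) (τ j), l y = c := by
  set w := AffineMap.lineMap p q ((c - l p) / (l q - l p)) with hw
  have hpos : 0 < l q - l p := by linarith
  have hwc : l w = c := by
    rw [hw, AffineMap.lineMap_apply]
    simp only [vsub_eq_sub, vadd_eq_add, map_add, map_smul, map_sub, smul_eq_mul]
    field_simp
    ring
  have hwmem : w ∈ convexHull ℝ (⋃ i, homothet P (x i) (τ i)) := by
    refine (convex_convexHull ℝ _).segment_subset (subset_convexHull ℝ _ hp)
      (subset_convexHull ℝ _ hq) ?_
    rw [segment_eq_image_lineMap]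
    exact ⟨_, ⟨div_nonneg (by linarith) hpos.le, (div_le_one hpos).2 (by linarith)⟩, rfl⟩
  obtain ⟨j, y, hyH, hy⟩ := hWNS _ hF
    (AffineSubspace.mk' w (LinearMap.ker (l : EuclideanSpace ℝ (Fin d) →ₗ[ℝ] ℝ)))
    (by
      rw [AffineSubspace.parallel_iff_direction_eq_and_eq_bot_iff_eq_bot,
        AffineSubspace.direction_mk', direction_affineSpan, hspan]
      refine ⟨rfl, iff_of_false ?_ ?_⟩
      · exact (AffineSubspace.nonempty_iff_ne_bot _).1 (AffineSubspace.mk'_nonempty _ _)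
      · rw [affineSpan_eq_bot]
        exact hF.2.1.ne_empty) ⟨w, AffineSubspace.self_mem_mk' _ _, hwmem⟩
  refine ⟨j, y, hy, ?_⟩
  have : y -ᵥ w ∈ LinearMap.ker (l : EuclideanSpace ℝ (Fin d) →ₗ[ℝ] ℝ) :=
    (AffineSubspace.mem_mk' ..).1 hyH
  have h0 : l y - l w = 0 := by simpa using this
  linarith

theorem mem_homothet_iff {d : ℕ} {P : Set (EuclideanSpace ℝ (Fin d))}
    {x q : EuclideanSpace ℝ (Fin d)} {τ : ℝ} :
    q ∈ homothet P x τ ↔ ∃ p ∈ P, q = x + τ • p := by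
  simp only [homothet, Set.mem_vadd_set, Set.mem_smul_set, vadd_eq_add]
  constructor
  · rintro ⟨_, ⟨p, hp, rfl⟩, rfl⟩
    exact ⟨p, hp, rfl⟩
  · rintro ⟨p, hp, rfl⟩
    exact ⟨_, ⟨p, hp, rfl⟩, rfl⟩

/-- If `-P` is contained in a translate of `s P`, a weakly non-separable family can be covered by
a homothetic copy of `P` of ratio `(s + 1) / 2 * ∑ i, τ i`. -/
theorem IsWNSFamily.smallestCoveringRatio_le {d n : ℕ} (hn : n ≠ 0)
    {P : Set (EuclideanSpace ℝ (Fin d))}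
    (hP : IsFullDimPolytope P) {x : Fin n → EuclideanSpace ℝ (Fin d)} {τ : Fin n → ℝ}
    (hτ : ∀ i, 0 < τ i) (hWNS : IsWNSFamily P x τ) {s : ℝ} (hs : 1 ≤ s)
    (t : EuclideanSpace ℝ (Fin d)) (ht : ∀ k ∈ P, ∃ p ∈ P, -k = t + s • p) :
    smallestCoveringRatio P (⋃ i, homothet P (x i) (τ i)) ≤ (s + 1) / 2 * ∑ i, τ i := by
  have : Nonempty (Fin n) := ⟨⟨0, Nat.pos_of_ne_zero hn⟩⟩
  set T := ∑ i, τ i with hT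
  have hT0 : 0 < T := Finset.sum_pos (fun i _ => hτ i) Finset.univ_nonempty
  set R := (s + 1) / 2 * T with hR
  have hR0 : 0 < R := by positivity
  -- With this centre the hypothesis becomes `-(P - o) ⊆ s (P - o)`. The cover is centred at `z`,
  -- the mean of the members' centres weighted by `τ i`.
  set o := -(1 / (1 + s)) • t with ho
  set z := (1 / T) • ∑ i, τ i • (x i + τ i • o) with hz
  refine csInf_le ⟨0, fun r hr => hr.1.le⟩ ⟨hR0, z - R • o, ?_⟩
  intro q hq
  rw [mem_homothet_iff]
  refine ⟨R⁻¹ • (q - (z - R • o)), ?_, by rw [smul_inv_smul₀ hR0.ne']; abel⟩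
  by_contra hnot
  obtain ⟨l, M, hle, hF, hspan, hlt⟩ := hP.exists_isFacet_lt hnot
  obtain ⟨pM, hpM, hpMl⟩ := hF.2.1
  obtain ⟨k, hk, hkmin⟩ := hP.isCompact.exists_isMinOn hP.nonempty l.continuous.continuousOn
  set m := l k with hm
  have hkmin' : ∀ p ∈ P, m ≤ l p := fun p hp => hkmin hp
  have hmM : m ≤ M := hle k hk
  have hoto : (1 + s) * l o = - l t := by
    rw [ho]
    simp only [neg_smul, map_neg, map_smul, smul_eq_mul]
    field_simp
  have hsym : -m ≤ s * M - (1 + s) * l o := by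
    obtain ⟨p, hp, hkp⟩ := ht k hk
    have h1 : -m = l t + s * l p := by rw [hm, ← map_neg, hkp]; simp
    have h2 := mul_le_mul_of_nonneg_left (hle p hp) (by linarith : 0 ≤ s)
    linarith
  have hub : ∀ i, ∀ y ∈ homothet P (x i) (τ i), l y ≤ l (x i) + τ i * M := by
    intro i y hy
    obtain ⟨p, hp, rfl⟩ := mem_homothet_iff.1 hy
    have := mul_le_mul_of_nonneg_left (hle p hp) (hτ i).le
    simpa using this
  have hlb : ∀ i, ∀ y ∈ homothet P (x i) (τ i), l (x i) + τ i * m ≤ l y := by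
    intro i y hy
    obtain ⟨p, hp, rfl⟩ := mem_homothet_iff.1 hy
    have := mul_le_mul_of_nonneg_left (hkmin' p hp) (hτ i).le
    simpa using this
  -- Under `l` the members project into intervals of length `τ j * (M - m)`; by WNS these cover
  -- every level from the top of member `i` to `q`.
  have hlen : ∀ i, l q - (l (x i) + τ i * M) ≤
      (M - m) * ∑ j, if l (x i) + τ i * M < l (x j) + τ j * M then τ j else 0 := by
    intro i
    refine (sub_le_sum_length_of_cover (fun j => l (x j) + τ j * m)
      (fun j => l (x j) + τ j * M)
      (fun j => by have := mul_le_mul_of_nonneg_left hmM (hτ j).le; linarith) i (l q) ?_).trans_eq ?_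
    · intro c hc1 hc2
      have hmem : x i + τ i • pM ∈ ⋃ i, homothet P (x i) (τ i) :=
        Set.mem_iUnion.2 ⟨i, mem_homothet_iff.2 ⟨pM, hpM, rfl⟩⟩
      obtain ⟨j, y, hy, rfl⟩ := hWNS.exists_mem_homothet hF hspan hmem hq (c := c)
        (by simpa [hpMl] using hc1) hc2
      exact ⟨j, hlb j y hy, hub j y hy⟩
    · rw [Finset.mul_sum]
      refine Finset.sum_congr rfl fun j _ => ?_
      split_ifs <;> ring
  have hsum := Finset.sum_le_sum fun i (_ : i ∈ Finset.univ) =>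
    mul_le_mul_of_nonneg_left (hlen i) (hτ i).le
  have hpair := sum_mul_sum_ite_lt_le τ (fun i => l (x i) + τ i * M) fun i => (hτ i).le
  set Q := ∑ i, τ i ^ 2 with hQ
  have hQ0 : 0 ≤ Q := Finset.sum_nonneg fun i _ => sq_nonneg _
  set D := ∑ i, τ i * ∑ j, (if l (x i) + τ i * M < l (x j) + τ j * M then τ j else 0) with hD
  have hL : ∑ i, τ i * (l q - (l (x i) + τ i * M)) =
      T * l q - ∑ i, τ i * l (x i) - M * Q := by
    rw [hT, hQ, Finset.sum_mul, Finset.mul_sum, ← Finset.sum_sub_distrib,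
      ← Finset.sum_sub_distrib]
    exact Finset.sum_congr rfl fun i _ => by ring
  have hRt : ∑ i, τ i * ((M - m) *
      ∑ j, (if l (x i) + τ i * M < l (x j) + τ j * M then τ j else 0)) = (M - m) * D := by
    rw [hD, Finset.mul_sum]
    exact Finset.sum_congr rfl fun i _ => by ring
  rw [hL, hRt] at hsum
  have hlz : T * l z = ∑ i, τ i * l (x i) + l o * Q := by
    rw [hz, hQ]
    simp only [map_smul, map_sum, map_add, smul_eq_mul]
    rw [← mul_assoc, mul_one_div_cancel hT0.ne', one_mul, Finset.mul_sum,
      ← Finset.sum_add_distrib]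
    exact Finset.sum_congr rfl fun i _ => by ring
  have hlt' : R * M < l q - l z + R * l o := by
    have h1 : l (R⁻¹ • (q - (z - R • o))) = R⁻¹ * (l q - l z + R * l o) := by
      simp only [map_smul, map_sub, smul_eq_mul]
      ring
    rw [h1, lt_inv_mul_iff₀ hR0] at hlt
    exact hlt
  have hDle := mul_le_mul_of_nonneg_left hpair (sub_nonneg.2 hmM)
  have hTR : T * (R * M) < T * (l q - l z + R * l o) := mul_lt_mul_of_pos_left hlt' hT0
  have hQT : Q ≤ T ^ 2 := by
    have h0 : 0 ≤ D := Finset.sum_nonneg fun i _ => mul_nonneg (hτ i).le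
      (Finset.sum_nonneg fun j _ => by split_ifs <;> [exact (hτ j).le; exact le_rfl])
    linarith
  have ha : 0 ≤ M - l o := by nlinarith
  have h5 : (l o - m) * (T ^ 2 - Q) ≤ s * (M - l o) * (T ^ 2 - Q) :=
    mul_le_mul_of_nonneg_right (by linarith) (by linarith)
  -- `Q` enters with coefficient `1` and `T ^ 2 - Q` with `(s + 1) / 2`; since `1 ≤ s`, both are
  -- absorbed in `(s + 1) / 2 * T ^ 2`.
  have h6 : 0 ≤ (s - 1) * (M - l o) * Q :=
    mul_nonneg (mul_nonneg (by linarith) ha) hQ0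
  rw [hR] at hTR
  nlinarith

/-! ### Certificates of asymmetry -/

/-- If no translate of `s P` contains `-P`, this is certified by at most `d + 1` points of `P` and
as many linear functionals that add up to zero. -/
theorem exists_functionals_of_forall_not_neg_subset {d : ℕ}
    {P : Set (EuclideanSpace ℝ (Fin d))} (hconv : Convex ℝ P) (hcomp : IsCompact P)
    (hne : P.Nonempty) {s : ℝ}
    (h : ∀ t, ∃ k ∈ P, ∀ p ∈ P, -k ≠ t + s • p) :
    ∃ (k : Fin (d + 1) → EuclideanSpace ℝ (Fin d))
      (w : Fin (d + 1) → StrongDual ℝ (EuclideanSpace ℝ (Fin d))) (m : Fin (d + 1) → ℝ),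
      (∀ i, k i ∈ P) ∧ (∀ x, ∑ i, w i x = 0) ∧ (∀ i, ∀ x ∈ P, w i x ≤ m i) ∧
      ∑ i, w i (k i) + s * ∑ i, m i < 0 := by
  classical
  -- `F k` is the set of translations `t` with `-k ∈ t + s P`.
  let F : EuclideanSpace ℝ (Fin d) → Set (EuclideanSpace ℝ (Fin d)) :=
    fun k => (fun p => -k - s • p) '' P
  have hFconv : ∀ k, Convex ℝ (F k) := by
    intro k
    have := hconv.affine_image (AffineMap.const ℝ (EuclideanSpace ℝ (Fin d)) (-k) -
      (s • AffineMap.id ℝ (EuclideanSpace ℝ (Fin d))))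
    exact this
  have hFcomp : ∀ k, IsCompact (F k) := fun k => hcomp.image (by fun_prop)
  have hempty : ¬ (⋂ k : P, F k).Nonempty := by
    rintro ⟨t, ht⟩
    obtain ⟨k, hk, hkt⟩ := h t
    obtain ⟨p, hp, hpt⟩ := Set.mem_iInter.1 ht ⟨k, hk⟩
    exact hkt p hp (by rw [← hpt]; simp)
  obtain ⟨I, hI, hIe⟩ : ∃ I : Finset P, I.card ≤ d + 1 ∧ ¬ (⋂ i ∈ I, F i).Nonempty := by
    by_contra! hcon
    refine hempty (Convex.helly_theorem_compact' (𝕜 := ℝ) (fun k : P => hFconv k)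
      (fun k => hFcomp k) fun I hI => hcon I ?_)
    rwa [finrank_euclideanSpace_fin] at hI
  -- Pads the Helly subfamily to exactly `d + 1` points, possibly repeated.
  obtain ⟨k, hk⟩ : ∃ k : Fin (d + 1) → P, ∀ i ∈ I, ∃ j, k j = i := by
    obtain ⟨e⟩ : Nonempty (I ↪ Fin (d + 1)) :=
      Function.Embedding.nonempty_of_card_le (by simpa using hI)
    have : Nonempty P := hne.to_subtype
    refine ⟨fun j => if hj : ∃ i, e i = j then (hj.choose : P) else Classical.arbitrary P,
      fun i hi => ⟨e ⟨i, hi⟩, ?_⟩⟩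
    have hj : ∃ i', e i' = e ⟨i, hi⟩ := ⟨_, rfl⟩
    change (if hj : ∃ i', e i' = e ⟨i, hi⟩ then (hj.choose : P) else Classical.arbitrary P) = i
    rw [dif_pos hj, e.injective hj.choose_spec]
  -- An empty intersection means that the product misses the diagonal. Separating the two yields all
  -- the functionals at once, and vanishing on the diagonal makes them sum to zero.
  have hdisj : Disjoint (Set.univ.pi fun j => F (k j))
      (LinearMap.range (LinearMap.pi fun _ : Fin (d + 1) =>
        (LinearMap.id : EuclideanSpace ℝ (Fin d) →ₗ[ℝ] EuclideanSpace ℝ (Fin d))) :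
        Set (Fin (d + 1) → EuclideanSpace ℝ (Fin d))) := by
    rw [Set.disjoint_left]
    rintro _ hy ⟨t, rfl⟩
    refine hIe ⟨t, Set.mem_iInter₂.2 fun i hi => ?_⟩
    obtain ⟨j, rfl⟩ := hk i hi
    exact hy j (Set.mem_univ j)
  obtain ⟨f, u, v, hu, huv, hv⟩ := geometric_hahn_banach_compact_closed
    (convex_pi fun j _ => hFconv (k j)) (isCompact_univ_pi fun j => hFcomp (k j))
    (Submodule.convex _) (Submodule.closed_of_finiteDimensional _) hdisj
  have hdiag : ∀ t, v < f fun _ => t := fun t => hv _ ⟨t, rfl⟩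
  have hv0 : v < 0 := by
    have := hdiag 0
    rwa [show (fun _ : Fin (d + 1) => (0 : EuclideanSpace ℝ (Fin d))) = 0 from rfl, map_zero]
      at this
  have hdiag0 : ∀ t, (f fun _ => t) = 0 := by
    intro t
    by_contra hne0
    have h1 := hdiag ((v / f fun _ => t) • t)
    have h2 : (fun _ : Fin (d + 1) => (v / f fun _ => t) • t) =
      (v / f fun _ => t) • fun _ => t := rfl
    rw [h2, map_smul, smul_eq_mul, div_mul_cancel₀ _ hne0] at h1
    exact lt_irrefl _ h1
  have hfsum : ∀ y : Fin (d + 1) → EuclideanSpace ℝ (Fin d),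
      ∑ i, f (Pi.single i (y i)) = f y := by
    intro y
    rw [← map_sum, Finset.univ_sum_single]
  let w : Fin (d + 1) → StrongDual ℝ (EuclideanSpace ℝ (Fin d)) :=
    fun i => -(f.comp (ContinuousLinearMap.single ℝ (fun _ => EuclideanSpace ℝ (Fin d)) i))
  have hw : ∀ i x, w i x = -f (Pi.single i x) := fun i x => rfl
  have hmax : ∀ i, ∃ p ∈ P, ∀ x ∈ P, w i x ≤ w i p := fun i =>
    hcomp.exists_isMaxOn hne (w i).continuous.continuousOn
  choose p hp hpmax using hmax
  refine ⟨fun i => k i, w, fun i => w i (p i), fun i => (k i).2, ?_, hpmax, ?_⟩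
  · intro x
    simp only [hw, Finset.sum_neg_distrib]
    rw [hfsum fun _ => x, hdiag0, neg_zero]
  · have h1 := hu (fun i => -(k i : EuclideanSpace ℝ (Fin d)) - s • p i)
      fun i _ => ⟨p i, hp i, rfl⟩
    rw [← hfsum] at h1
    have h2 : ∀ i, f (Pi.single i (-(k i : EuclideanSpace ℝ (Fin d)) - s • p i)) =
        w i (k i) + s * w i (p i) := by
      intro i
      have h3 : w i (-(-(k i : EuclideanSpace ℝ (Fin d)) - s • p i)) =
        f (Pi.single i (-(k i : EuclideanSpace ℝ (Fin d)) - s • p i)) := by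
        rw [map_neg, hw, neg_neg]
      rw [← h3]
      simp only [neg_sub, sub_neg_eq_add, map_add, map_smul, smul_eq_mul]
      ring
    simp only [h2, Finset.sum_add_distrib, ← Finset.mul_sum] at h1
    linarith

/-! ### Approximate barycentric coordinates and closeness to a simplex -/

theorem AffineBasis.coord_sum_smul {ι E : Type*} [Fintype ι] [AddCommGroup E] [Module ℝ E]
    (b : AffineBasis ι ℝ E) (c : ι → ℝ) (hc : ∑ i, c i = 1) (i : ι) :
    b.coord i (∑ j, c j • b j) = c i := by
  rw [← Finset.affineCombination_eq_linear_combination _ _ _ hc,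
    b.coord_apply_combination_of_mem (Finset.mem_univ i) hc]

/-- A closed convex set containing points close to the vertices of a simplex contains a slightly
smaller concentric simplex. -/
theorem AffineBasis.mem_of_forall_le_coord {ι E : Type*} [Fintype ι] [Nonempty ι]
    [NormedAddCommGroup E] [NormedSpace ℝ E] (b : AffineBasis ι ℝ E)
    {C : Set E} (hconv : Convex ℝ C) (hclosed : IsClosed C) {δ : ℝ} (y : ι → E)
    (hyC : ∀ j, y j ∈ C) (hy0 : ∀ i j, 0 ≤ b.coord i (y j))
    (hy1 : ∀ j, 1 - δ ≤ b.coord j (y j)) (hδ : 0 ≤ δ) {x : E} (hx : ∀ i, δ ≤ b.coord i x) :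
    x ∈ C := by
  by_contra hxC
  obtain ⟨f, u, hfC, hfx⟩ := geometric_hahn_banach_closed_point hconv hclosed hxC
  have hf : ∀ z, f z = ∑ i, b.coord i z * f (b i) := by
    intro z
    conv_lhs => rw [← b.linear_combination_coord_eq_self z]
    simp only [map_sum, map_smul, smul_eq_mul]
  -- With `r` the oscillation of `f` over the vertices, `f (y M)` is at least `f (b M) - δ * r`,
  -- while weight `δ` at `b m` keeps `f x` at most that.
  obtain ⟨M, hM⟩ := Finite.exists_max fun i => f (b i)
  obtain ⟨m, hm⟩ := Finite.exists_min fun i => f (b i)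
  have h1 : (1 - δ) * (f (b M) - f (b m)) ≤ f (y M) - f (b m) := by
    have e : f (y M) - f (b m) = ∑ i, b.coord i (y M) * (f (b i) - f (b m)) := by
      simp only [mul_sub, Finset.sum_sub_distrib, ← Finset.sum_mul,
        b.sum_coord_apply_eq_one, ← hf, one_mul]
    rw [e]
    refine le_trans (mul_le_mul_of_nonneg_right (hy1 M) (sub_nonneg.2 (hm M))) ?_
    exact Finset.single_le_sum (f := fun i => b.coord i (y M) * (f (b i) - f (b m)))
      (fun i _ => mul_nonneg (hy0 i M) (sub_nonneg.2 (hm i))) (Finset.mem_univ M)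
  have h2 : δ * (f (b M) - f (b m)) ≤ f (b M) - f x := by
    have e : f (b M) - f x = ∑ i, b.coord i x * (f (b M) - f (b i)) := by
      simp only [mul_sub, Finset.sum_sub_distrib, ← Finset.sum_mul,
        b.sum_coord_apply_eq_one, ← hf, one_mul]
    rw [e]
    refine le_trans (mul_le_mul_of_nonneg_right (hx m) (sub_nonneg.2 (hM m))) ?_
    exact Finset.single_le_sum (f := fun i => b.coord i x * (f (b M) - f (b i)))
      (fun i _ => mul_nonneg (hδ.trans (hx i)) (sub_nonneg.2 (hM i))) (Finset.mem_univ m)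
  have h3 := hfC _ (hyC M)
  linarith

/-- If `P` carries `d + 1` nonnegative affine functions with sum `1`, each of which is at least
`1 - δ` somewhere on `P`, then `P` is close to a simplex. -/
theorem banachMazurDist_le_of_barycentric {d : ℕ}
    {P : Set (EuclideanSpace ℝ (Fin d))} (hconv : Convex ℝ P) (hcomp : IsCompact P)
    (S : Affine.Simplex ℝ (EuclideanSpace ℝ (Fin d)) d) {δ : ℝ} (hδ : 0 < δ)
    (hδ1 : ((d : ℝ) + 1) * δ < 1)
    (φ : Fin (d + 1) → StrongDual ℝ (EuclideanSpace ℝ (Fin d))) (a : Fin (d + 1) → ℝ)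
    (hsum : ∀ x, ∑ i, (φ i x + a i) = 1) (hnn : ∀ i, ∀ x ∈ P, 0 ≤ φ i x + a i)
    (k : Fin (d + 1) → EuclideanSpace ℝ (Fin d)) (hk : ∀ i, k i ∈ P)
    (hk1 : ∀ i, 1 - δ ≤ φ i (k i) + a i) :
    banachMazurDist P (convexHull ℝ (Set.range S.points)) ≤
      ENNReal.ofReal (1 / (1 - ((d : ℝ) + 1) * δ)) := by
  set μ := 1 - ((d : ℝ) + 1) * δ with hμ
  have hμ0 : 0 < μ := by linarith
  let b : AffineBasis (Fin (d + 1)) ℝ (EuclideanSpace ℝ (Fin d)) :=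
    ⟨S.points, S.independent, S.independent.affineSpan_eq_top_iff_card_eq_finrank_add_one.2
      (by simp)⟩
  have hS : convexHull ℝ (Set.range S.points) = {x | ∀ i, 0 ≤ b.coord i x} :=
    b.convexHull_eq_nonneg_coord
  let g : EuclideanSpace ℝ (Fin d) →L[ℝ] EuclideanSpace ℝ (Fin d) :=
    ∑ i, (φ i).smulRight (b i)
  set c := ∑ i, a i • b i with hc
  have hG : ∀ x, g x + c = ∑ i, (φ i x + a i) • b i := by
    intro x
    simp [g, hc, add_smul, Finset.sum_add_distrib]
  have hcoord : ∀ i x, b.coord i (g x + c) = φ i x + a i := by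
    intro i x
    rw [hG, b.coord_sum_smul (fun i => φ i x + a i) (hsum x)]
  have hGS : ∀ p ∈ P, g p + c ∈ convexHull ℝ (Set.range S.points) := by
    intro p hp
    rw [hS]
    intro i
    rw [hcoord]
    exact hnn i p hp
  -- `y ↦ q + μ • y` shrinks the simplex towards its centroid, making all coordinates at least `δ`.
  set q := δ • ∑ i, b i with hq
  have hinner : ∀ y ∈ convexHull ℝ (Set.range S.points), ∃ p ∈ P, q + μ • y = g p + c := by
    intro y hy
    rw [hS] at hy
    have hmem : q + μ • y ∈ (fun p => g p + c) '' P := by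
      refine b.mem_of_forall_le_coord (C := (fun p => g p + c) '' P) (δ := δ) ?_ ?_ (fun j => g (k j) + c)
        (fun j => ⟨k j, hk j, rfl⟩) (fun i j => ?_) (fun j => ?_) hδ.le fun i => ?_
      · exact hconv.affine_image (g.toLinearMap.toAffineMap + AffineMap.const ℝ _ c)
      · exact (hcomp.image (by fun_prop)).isClosed
      · rw [hcoord]
        exact hnn i _ (hk j)
      · rw [hcoord]
        exact hk1 j
      · have e : q + μ • y = ∑ j, (δ + μ * b.coord j y) • b j := by
          conv_lhs => rw [← b.linear_combination_coord_eq_self y]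
          simp only [hq, Finset.smul_sum, add_smul, Finset.sum_add_distrib, mul_smul]
        rw [e, b.coord_sum_smul]
        · have := mul_nonneg hμ0.le (hy i)
          linarith
        · rw [Finset.sum_add_distrib, ← Finset.mul_sum, b.sum_coord_apply_eq_one]
          simp [hμ]
    obtain ⟨p, hp, hpe⟩ := hmem
    exact ⟨p, hp, hpe.symm⟩
  have hvert : ∀ i, b i ∈ convexHull ℝ (Set.range S.points) := fun i =>
    subset_convexHull ℝ _ ⟨i, rfl⟩
  have hsurj : LinearMap.range (g : EuclideanSpace ℝ (Fin d) →ₗ[ℝ] EuclideanSpace ℝ (Fin d)) = ⊤ := by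
    rw [eq_top_iff, ← AffineSubspace.direction_top ℝ (EuclideanSpace ℝ (Fin d))
      (EuclideanSpace ℝ (Fin d)), ← b.tot, direction_affineSpan]
    refine Submodule.span_le.2 ?_
    rintro _ ⟨_, ⟨i, rfl⟩, _, ⟨j, rfl⟩, rfl⟩
    obtain ⟨p, -, hp⟩ := hinner _ (hvert i)
    obtain ⟨p', -, hp'⟩ := hinner _ (hvert j)
    refine ⟨μ⁻¹ • (p - p'), ?_⟩
    have e : g (p - p') = μ • (b i - b j) := by
      rw [map_sub, eq_sub_of_add_eq hp.symm, eq_sub_of_add_eq hp'.symm]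
      module
    change g (μ⁻¹ • (p - p')) = b i - b j
    rw [map_smul, e, inv_smul_smul₀ hμ0.ne']
  let T := (LinearEquiv.ofBijective (g : EuclideanSpace ℝ (Fin d) →ₗ[ℝ] EuclideanSpace ℝ (Fin d))
    ⟨LinearMap.injective_iff_surjective.2 (LinearMap.range_eq_top.1 hsurj),
      LinearMap.range_eq_top.1 hsurj⟩).symm
  have hT : ∀ x, T (g x) = x := fun x =>
    (LinearEquiv.ofBijective (g : EuclideanSpace ℝ (Fin d) →ₗ[ℝ] EuclideanSpace ℝ (Fin d)) _).symm_apply_apply x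
  -- Translating by `v` puts the centroid at the origin, so that the shrinking becomes
  -- multiplication by `μ`.
  set v := -(1 / ((d : ℝ) + 1)) • ∑ i, b i with hv
  have hqv : μ • v = v + q := by
    have hd : (d : ℝ) + 1 ≠ 0 := by positivity
    rw [hv, hq, smul_smul, ← add_smul]
    congr 1
    rw [hμ]
    field_simp
    ring
  refine sInf_le ⟨1 / μ, by positivity, rfl, T, T (c + v), v, ?_, ?_⟩
  · rintro _ ⟨p, hp, rfl⟩
    refine ⟨v + (g p + c), ⟨_, hGS p hp, rfl⟩, ?_⟩
    rw [show v + (g p + c) = (c + v) + g p by abel, map_add, hT]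
    rfl
  · rintro _ ⟨_, ⟨y, hy, rfl⟩, rfl⟩
    obtain ⟨p, hp, hpe⟩ := hinner y hy
    refine ⟨T (c + v) + p, ⟨p, hp, rfl⟩, ?_⟩
    have e : μ • (v + y) = (c + v) + g p := by
      rw [smul_add, hqv, add_assoc, hpe]
      abel
    change (1 / μ) • (T (c + v) + p) = T (v + y)
    rw [← hT p]
    rw [← map_add, ← e, map_smul, one_div, inv_smul_smul₀ hμ0.ne']

/-- A convex body whose Minkowski measure of asymmetry is close to `d` is close to a simplex. -/
theorem banachMazurDist_simplex_le {d : ℕ}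
    {P : Set (EuclideanSpace ℝ (Fin d))} (hconv : Convex ℝ P) (hcomp : IsCompact P)
    (hne : P.Nonempty) (S : Affine.Simplex ℝ (EuclideanSpace ℝ (Fin d)) d) {δ : ℝ} (hδ : 0 < δ)
    (hδ1 : ((d : ℝ) + 1) * δ < 1)
    (h : ∀ t, ∃ k ∈ P, ∀ p ∈ P, -k ≠ t + ((d : ℝ) - δ) • p) :
    banachMazurDist P (convexHull ℝ (Set.range S.points)) ≤
      ENNReal.ofReal (1 / (1 - ((d : ℝ) + 1) * δ)) := by
  obtain ⟨k, w, m, hk, hw0, hwm, hlt⟩ :=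
    exists_functionals_of_forall_not_neg_subset hconv hcomp hne h
  set A := ∑ i, m i with hA
  have hA' : ∀ x, ∑ i, (m i - w i x) = A := by
    intro x
    rw [Finset.sum_sub_distrib, hw0, sub_zero]
  have hdiag : ((d : ℝ) + 1 - δ) * A < ∑ i, (m i - w i (k i)) := by
    rw [Finset.sum_sub_distrib]
    linarith
  have hle : ∀ i, m i - w i (k i) ≤ A := fun i => by
    rw [← hA' (k i)]
    exact Finset.single_le_sum (f := fun j => m j - w j (k i))
      (fun j _ => sub_nonneg.2 (hwm j _ (hk i))) (Finset.mem_univ i)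
  have hA0 : 0 < A := by
    have h1 : ∑ i, (m i - w i (k i)) ≤ ∑ _i : Fin (d + 1), A :=
      Finset.sum_le_sum fun i _ => hle i
    simp only [Finset.sum_const, Finset.card_univ, Fintype.card_fin, nsmul_eq_mul] at h1
    push_cast at h1
    nlinarith
  refine banachMazurDist_le_of_barycentric hconv hcomp S hδ hδ1 (fun i => -(1 / A) • w i)
    (fun i => m i / A) ?_ ?_ k hk ?_
  all_goals
    have hφ : ∀ i x, (-(1 / A) • w i) x + m i / A = (m i - w i x) / A := by
      intro i x
      simp only [smul_apply, smul_eq_mul]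
      ring
    simp only [hφ]
  · intro x
    rw [← Finset.sum_div, hA', div_self hA0.ne']
  · exact fun i x hx => div_nonneg (sub_nonneg.2 (hwm i x hx)) hA0.le
  -- The `d + 1` terms are at most `A` and add up to more than `(d + 1 - δ) * A`, so each exceeds
  -- `(1 - δ) * A`.
  · intro i
    rw [le_div_iff₀ hA0]
    have h1 : ∑ j ∈ Finset.univ.erase i, (m j - w j (k j)) ≤
        ∑ _j ∈ Finset.univ.erase i, A := Finset.sum_le_sum fun j _ => hle j
    have h2 := Finset.add_sum_erase Finset.univ (fun j => m j - w j (k j)) (Finset.mem_univ i)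
    simp only [Finset.sum_const, Finset.card_erase_of_mem (Finset.mem_univ i), Finset.card_univ,
      Fintype.card_fin, Nat.add_sub_cancel, nsmul_eq_mul] at h1
    linarith

theorem mainTheorem5 (d n : ℕ) (hd : 2 ≤ d) (hn : 2 ≤ n)
    (ε : ℝ) (hε : 0 < ε) (hε' : ε < 1 / (16 * (1 + (d : ℝ))))
    (P : Set (EuclideanSpace ℝ (Fin d))) (hP : IsFullDimPolytope P)
    (x : Fin n → EuclideanSpace ℝ (Fin d)) (τ : Fin n → ℝ) (hτ : ∀ i, 0 < τ i)
    (hWNS : IsWNSFamily P x τ)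
    (hcover : (((d : ℝ) + 1) / 2 - ε) * ∑ i, τ i ≤
      smallestCoveringRatio P (⋃ i, homothet P (x i) (τ i)))
    (S : Affine.Simplex ℝ (EuclideanSpace ℝ (Fin d)) d) :
    banachMazurDist P (convexHull ℝ (Set.range S.points)) ≤
      ENNReal.ofReal (1 + 16 * ((d : ℝ) + 1) * ε) := by
  have hd' : (2 : ℝ) ≤ d := by exact_mod_cast hd
  have hdε : ((d : ℝ) + 1) * ε < 1 / 16 := by
    rw [lt_div_iff₀ (by positivity)] at hε'
    linarith
  have hdε0 : 0 < ((d : ℝ) + 1) * ε := by positivity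
  have hT0 : 0 < ∑ i, τ i := by
    have : Nonempty (Fin n) := ⟨⟨0, by omega⟩⟩
    exact Finset.sum_pos (fun i _ => hτ i) Finset.univ_nonempty
  -- For `s = d - 4 * ε` the covering factor is `(d + 1) / 2 - 2 * ε`, strictly below the assumed
  -- one.
  have hasym : ∀ t, ∃ k ∈ P, ∀ p ∈ P, -k ≠ t + ((d : ℝ) - 4 * ε) • p := by
    by_contra! hcon
    obtain ⟨t, ht⟩ := hcon
    have h1 := hcover.trans (hWNS.smallestCoveringRatio_le (by omega) hP hτ
      (by nlinarith : 1 ≤ (d : ℝ) - 4 * ε) t ht)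
    have h2 := le_of_mul_le_mul_right h1 hT0
    linarith
  refine (banachMazurDist_simplex_le hP.convex hP.isCompact hP.nonempty S
    (by positivity : 0 < 4 * ε) (by linarith) hasym).trans (ENNReal.ofReal_le_ofReal ?_)
  -- With `y = (d + 1) * ε` this is `1 ≤ (1 + 16 * y) * (1 - 4 * y)`, true for `0 ≤ y ≤ 3 / 16`.
  rw [div_le_iff₀ (by linarith)]
  nlinarith
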